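/- Let $a,q,\alpha,\beta,\gamma,\delta,\varepsilon\in\mathbb C$ satisfy the Fuchsian relation $1+\alpha+\beta=\gamma+\delta+\varepsilon$ and $$a=\tfrac12,\qquad \gamma+\delta=2,\qquad q=a\alpha\beta+a(1-\delta)\varepsilon .$$ Assume that $\operatorname{Re}\gamma>1$ and that none of $\gamma+\varepsilon$, $\frac{\gamma+\alpha}{2}$, $\frac{\gamma+\beta}{2}$ is zero or a negative integer. Consider the hypergeometric expansion associated with the general Heun equation with these parameters, $$u(z)=\sum_{n=0}^{\infty}a_n\,{}_2F_1(\alpha,\beta;\gamma+\varepsilon+n;z),\qquad |z|\le 1,$$ where $a_0=1$, $a_{-1}=0$ and, for $n\ge1$, $R_na_n+Q_{n-1}a_{n-1}+P_{n-2}a_{n-2}=0$ with $$R_n=(1-a)n(\varepsilon+\gamma+n-1),\qquad Q_n=-R_n+a(1+n-\delta)(n+\varepsilon)+(a\alpha\beta-q),$$ $$P_n=-\frac{a}{n+\varepsilon+\gamma}(n+\varepsilon)(n+\varepsilon+\gamma-\alpha)(n+\varepsilon+\gamma-\beta)$$ (the term with $P_{-1}$ is absent). Then the series of every ${}_2F_1(\alpha,\beta;\gamma+\varepsilon+n;z)$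 and the expansion itself converge absolutely for $|z|\le1$, the function $u$ on the closed unit disc is continuous at $z=1$, the ${}_3F_2$ series below converges absolutely, and $$u(1)=\frac{\Gamma(\gamma+\varepsilon)\,\Gamma(\gamma-1)}{\Gamma(\gamma+\varepsilon-\alpha)\,\Gamma(\gamma-1+\alpha)}\;{}_3F_2\!\left(\frac{\gamma-1}{2},\frac{\gamma}{2},\frac{\varepsilon}{2};\frac{\gamma+\alpha}{2},\frac{\gamma+\beta}{2};1\right),$$ where $1/\Gamma$ is read as $0$ at the poles of $\Gamma$. -/

import Mathlib

noncomputable section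

/-- Coefficient `R_n = (1 - a) n (γ + ε + n - 1)` of the three-term recurrence relation. -/
def heunR (a γ ε : ℂ) (n : ℕ) : ℂ :=
  (1 - a) * n * (ε + γ + n - 1)

/-- Coefficient `Q_n = -R_n + a (1 + n - δ) (n + ε) + (a α β - q)`. -/
def heunQ (a q α β γ δ ε : ℂ) (n : ℕ) : ℂ :=
  -heunR a γ ε n + a * (1 + n - δ) * (n + ε) + (a * α * β - q)

/-- Coefficient
`P_n = -a / (n + ε + γ) * (n + ε) (n + ε + γ - α) (n + ε + γ - β)`. -/
def heunP (a α β γ ε : ℂ) (n : ℕ) : ℂ :=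
  -(a / (n + ε + γ)) * (n + ε) * (n + ε + γ - α) * (n + ε + γ - β)

/-- The coefficients of the hypergeometric expansion for the general Heun equation: `a_0 = 1`,
and `R_n a_n + Q_{n-1} a_{n-1} + P_{n-2} a_{n-2} = 0` for `n ≥ 1`, with `a_{-1} = 0`.
The recurrence determines them when `a ≠ 1` and `γ + ε` is not a non-positive integer. -/
def heunCoeff (a q α β γ δ ε : ℂ) : ℕ → ℂ
  | 0 => 1
  | 1 => -(heunQ a q α β γ δ ε 0) / heunR a γ ε 1
  | n + 2 =>
      -(heunQ a q α β γ δ ε (n + 1) * heunCoeff a q α β γ δ ε (n + 1)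
        + heunP a α β γ ε n * heunCoeff a q α β γ δ ε n) / heunR a γ ε (n + 2)

/-- The `n`-th term `a_n * ₂F₁(α, β; γ + ε + n; z)` of the expansion. -/
def heunTerm (a q α β γ δ ε : ℂ) (z : ℂ) (n : ℕ) : ℂ :=
  heunCoeff a q α β γ δ ε n * ordinaryHypergeometric α β (γ + ε + n) z

/-- The expansion `u(z) = ∑ a_n * ₂F₁(α, β; γ + ε + n; z)`. -/
def heunExpansion (a q α β γ δ ε : ℂ) (z : ℂ) : ℂ :=
  ∑' n : ℕ, heunTerm a q α β γ δ ε z n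

/-- The `k`-th term of Clausen's series `₃F₂(a₁, a₂, a₃; b₁, b₂; z)`. -/
def clausenTerm (a₁ a₂ a₃ b₁ b₂ z : ℂ) (k : ℕ) : ℂ :=
  (ascPochhammer ℂ k).eval a₁ * (ascPochhammer ℂ k).eval a₂ * (ascPochhammer ℂ k).eval a₃ /
    ((ascPochhammer ℂ k).eval b₁ * (ascPochhammer ℂ k).eval b₂ * (k.factorial : ℂ)) * z ^ k

/-- Clausen's generalized hypergeometric function `₃F₂(a₁, a₂, a₃; b₁, b₂; z)`. -/
def clausen (a₁ a₂ a₃ b₁ b₂ z : ℂ) : ℂ :=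
  ∑' k : ℕ, clausenTerm a₁ a₂ a₃ b₁ b₂ z k

end

/-!
The choice of `a`, `γ + δ` and `q` makes every `Q_n` vanish, so the three-term recurrence becomes a
two-term one: the odd coefficients are zero and the even ones are the terms of a Clausen series.
At `z = 1` the contiguity relation `c (c - α - β) F(c) = (c - α) (c - β) F(c + 1)` for
`F(c) = ₂F₁(α, β; c; 1)` lets one factor `₂F₁(α, β; γ + ε; 1)` out of every term, and what remains
is again the term of a Clausen series. The same relation, iterated and combined with
`F(c + m) → 1` and `(x)_n / (y)_n ~ n ^ (x - y) Γ(y) / Γ(x)`, gives Gauss's value of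
`₂F₁(α, β; γ + ε; 1)`.
-/

section Pochhammer

open Filter Asymptotics Complex
open scoped Topology Nat

theorem ascPochhammer_eval_eq_prod_range {S : Type*} [CommSemiring S] (n : ℕ) (x : S) :
    (ascPochhammer S n).eval x = ∏ j ∈ Finset.range n, (x + j) := by
  induction n with
  | zero => simp
  | succ n ih => rw [ascPochhammer_succ_eval, Finset.prod_range_succ, ih]

theorem ascPochhammer_eval_ne_zero {R : Type*} [CommRing R] [IsDomain R] {x : R}
    (hx : ∀ m : ℕ, x ≠ -m) (n : ℕ) : (ascPochhammer R n).eval x ≠ 0 := fun h => by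
  obtain ⟨m, -, hm⟩ := (ascPochhammer_eval_eq_zero_iff n x).1 h
  exact hx m (by rw [hm, neg_neg])

theorem mul_ascPochhammer_eval_add_one {S : Type*} [CommSemiring S] (n : ℕ) (x : S) :
    x * (ascPochhammer S n).eval (x + 1) = (ascPochhammer S n).eval x * (x + n) := by
  rw [← ascPochhammer_succ_eval, ascPochhammer_succ_left]
  simp

theorem ascPochhammer_two_mul_eval {K : Type*} [Field K] [NeZero (2 : K)] (n : ℕ) (x : K) :
    (ascPochhammer K (2 * n)).eval x =
      4 ^ n * (ascPochhammer K n).eval (x / 2) * (ascPochhammer K n).eval ((x + 1) / 2) := by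
  induction n with
  | zero => simp
  | succ n ih =>
    have h₀ : x + 2 * n = 2 * (x / 2 + n) := by field_simp
    have h₁ : x + (2 * n + 1) = 2 * ((x + 1) / 2 + n) := by field_simp; ring
    rw [mul_add_one, ascPochhammer_succ_eval, ascPochhammer_succ_eval, ih]
    push_cast
    rw [h₀, h₁, ascPochhammer_succ_eval, ascPochhammer_succ_eval]
    ring

theorem norm_ascPochhammer_eval_ofReal_le {σ : ℝ} (hσ : 0 ≤ σ) {w : ℂ} (hw : σ ≤ w.re) (n : ℕ) :
    ‖(ascPochhammer ℂ n).eval (σ : ℂ)‖ ≤ ‖(ascPochhammer ℂ n).eval w‖ := by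
  simp only [ascPochhammer_eval_eq_prod_range, norm_prod]
  gcongr with j
  calc ‖(σ : ℂ) + j‖ = σ + j := by
        rw [← ofReal_natCast, ← ofReal_add, norm_real, Real.norm_of_nonneg (by positivity)]
    _ ≤ (w + j).re := by simpa using hw
    _ ≤ ‖w + j‖ := re_le_norm _

theorem GammaSeq_eq_div_ascPochhammer (x : ℂ) (n : ℕ) :
    GammaSeq x n = (n : ℂ) ^ x * n ! / (ascPochhammer ℂ (n + 1)).eval x := by
  rw [GammaSeq, ascPochhammer_eval_eq_prod_range]

/-- At a pole of `Γ` both sides vanish through the convention `0⁻¹ = 0`. -/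
theorem tendsto_inv_GammaSeq (x : ℂ) :
    Tendsto (fun n => (GammaSeq x n)⁻¹) atTop (𝓝 (Gamma x)⁻¹) := by
  by_cases! h : ∃ m : ℕ, x = -m
  · obtain ⟨m, rfl⟩ := h
    rw [Gamma_neg_nat_eq_zero, inv_zero]
    refine tendsto_const_nhds.congr' ?_
    filter_upwards [eventually_ge_atTop m] with n hn
    rw [GammaSeq_eq_div_ascPochhammer,
      ascPochhammer_eval_neg_coe_nat_of_lt (Nat.lt_succ_of_le hn), div_zero, inv_zero]
  · exact (GammaSeq_tendsto_Gamma x).inv₀ (Gamma_ne_zero h)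

theorem eventually_add_natCast_ne_zero (x : ℂ) : ∀ᶠ n : ℕ in atTop, x + n ≠ 0 := by
  filter_upwards [eventually_gt_atTop ⌈-x.re⌉₊] with n hn h
  have hre : x.re + n = 0 := by simpa using congrArg re h
  linarith [Nat.lt_of_ceil_lt hn]

/-- Poles of `Γ` are allowed: if `a` or `b` is one, both sides are eventually `0` by convention. -/
theorem tendsto_ascPochhammer_div_mul_cpow (a b : ℂ) :
    Tendsto (fun n : ℕ => (ascPochhammer ℂ n).eval a / (ascPochhammer ℂ n).eval b *
      (n : ℂ) ^ (b - a)) atTop (𝓝 (Gamma b / Gamma a)) := by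
  have hratio : Tendsto (fun n : ℕ => (b + 1 * (n : ℂ)) / (a + 1 * n)) atTop (𝓝 (1 / 1)) :=
    tendsto_add_mul_div_add_mul_atTop_nhds b a 1 one_ne_zero
  have hlim := ((GammaSeq_tendsto_Gamma b).mul (tendsto_inv_GammaSeq a)).mul hratio
  rw [div_one, mul_one, ← div_eq_mul_inv] at hlim
  refine hlim.congr' ?_
  filter_upwards [eventually_ne_atTop 0, eventually_add_natCast_ne_zero a,
    eventually_add_natCast_ne_zero b] with n hn ha hb
  have hn' : (n : ℂ) ≠ 0 := Nat.cast_ne_zero.2 hn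
  have hpow : (n : ℂ) ^ a ≠ 0 := by simp [cpow_eq_zero_iff, hn']
  have hfac : (n ! : ℂ) ≠ 0 := Nat.cast_ne_zero.2 n.factorial_ne_zero
  simp only [GammaSeq_eq_div_ascPochhammer, ascPochhammer_succ_eval, cpow_sub _ _ hn', one_mul]
  field_simp

theorem isBigO_ascPochhammer_div (a b : ℂ) :
    (fun n : ℕ => (ascPochhammer ℂ n).eval a / (ascPochhammer ℂ n).eval b) =O[atTop]
      fun n : ℕ => (n : ℝ) ^ (a - b).re := by
  have hpow : (fun n : ℕ => (n : ℂ) ^ (a - b)) =O[atTop] fun n : ℕ => (n : ℝ) ^ (a - b).re := by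
    refine .of_norm_eventuallyLE ?_
    filter_upwards [eventually_gt_atTop 0] with n hn
    rw [norm_natCast_cpow_of_pos hn]
  refine (((tendsto_ascPochhammer_div_mul_cpow a b).isBigO_one ℝ).mul hpow).congr' ?_ (by simp)
  filter_upwards [eventually_ne_atTop 0] with n hn
  rw [mul_assoc, ← cpow_add _ _ (Nat.cast_ne_zero.2 hn)]
  simp

end Pochhammer

section Clausen

open Asymptotics Filter

variable {a₁ a₂ a₃ b₁ b₂ : ℂ}

theorem clausenTerm_succ (a₁ a₂ a₃ b₁ b₂ z : ℂ) (k : ℕ) :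
    clausenTerm a₁ a₂ a₃ b₁ b₂ z (k + 1) =
      (a₁ + k) * (a₂ + k) * (a₃ + k) / ((b₁ + k) * (b₂ + k) * (k + 1)) * z *
        clausenTerm a₁ a₂ a₃ b₁ b₂ z k := by
  simp only [clausenTerm, ascPochhammer_succ_eval, Nat.factorial_succ, Nat.cast_mul,
    Nat.cast_add_one, div_eq_mul_inv, mul_inv, pow_succ]
  ring

theorem summable_clausenTerm_one (h : (a₁ + a₂ + a₃).re < (b₁ + b₂).re) :
    Summable (clausenTerm a₁ a₂ a₃ b₁ b₂ 1) := by
  have hO := ((isBigO_ascPochhammer_div a₁ b₁).mul (isBigO_ascPochhammer_div a₂ b₂)).mul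
    (isBigO_ascPochhammer_div a₃ 1)
  have hexp : (a₁ - b₁).re + (a₂ - b₂).re + (a₃ - 1).re < -1 := by
    simp only [Complex.add_re, Complex.sub_re, Complex.one_re] at h ⊢
    linarith
  refine summable_of_isBigO_nat (Real.summable_nat_rpow.2 hexp) (hO.congr' ?_ ?_)
  · refine .of_forall fun k => ?_
    simp only [clausenTerm, ascPochhammer_eval_one, one_pow, mul_one, div_mul_div_comm]
  · filter_upwards [eventually_gt_atTop 0] with k hk
    rw [Real.rpow_add (by positivity), Real.rpow_add (by positivity)]

end Clausen

section Hypergeometric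

open Filter Asymptotics Complex Metric
open scoped Topology Nat

section Contiguity

variable {K : Type*} [Field K]

theorem ordinaryHypergeometricCoefficient_succ (a b c : K) (n : ℕ) :
    ordinaryHypergeometricCoefficient a b c (n + 1) =
      (a + n) * (b + n) / ((c + n) * (n + 1)) * ordinaryHypergeometricCoefficient a b c n := by
  simp only [ordinaryHypergeometricCoefficient, ascPochhammer_succ_eval, Nat.factorial_succ,
    Nat.cast_mul, Nat.cast_add_one, div_eq_mul_inv, mul_inv]
  ring

theorem ordinaryHypergeometricCoefficient_add_one_right (a b : K) {c : K} (hc : c ≠ 0) (n : ℕ) :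
    ordinaryHypergeometricCoefficient a b (c + 1) n =
      c / (c + n) * ordinaryHypergeometricCoefficient a b c n := by
  have hinv : ((ascPochhammer K n).eval (c + 1))⁻¹ =
      c * (((ascPochhammer K n).eval c)⁻¹ * (c + n)⁻¹) := by
    rw [← mul_inv, ← mul_ascPochhammer_eval_add_one]
    field_simp
  rw [ordinaryHypergeometricCoefficient, hinv]
  ring

/-- The difference of the two sides of the contiguity relation telescopes. -/
theorem ordinaryHypergeometricCoefficient_contiguous [CharZero K] (a b : K) {c : K}
    (hc : ∀ m : ℕ, c ≠ -m) (n : ℕ) :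
    (c - a) * (c - b) * ordinaryHypergeometricCoefficient a b (c + 1) n -
        c * (c - a - b) * ordinaryHypergeometricCoefficient a b c n =
      c * ((n + 1 : ℕ) * ordinaryHypergeometricCoefficient a b c (n + 1)) -
        c * (n * ordinaryHypergeometricCoefficient a b c n) := by
  have hc₀ : c ≠ 0 := by simpa using hc 0
  have hcn : c + n ≠ 0 := fun h => hc n (eq_neg_of_add_eq_zero_left h)
  have hn : (n : K) + 1 ≠ 0 := n.cast_add_one_ne_zero
  rw [ordinaryHypergeometricCoefficient_succ,
    ordinaryHypergeometricCoefficient_add_one_right a b hc₀]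
  generalize ordinaryHypergeometricCoefficient a b c n = t
  push_cast
  field_simp
  ring

end Contiguity

variable {a b c : ℂ}

theorem isBigO_ordinaryHypergeometricCoefficient (a b c : ℂ) :
    ordinaryHypergeometricCoefficient a b c =O[atTop]
      fun n : ℕ => (n : ℝ) ^ ((a + b - c).re - 1) := by
  refine ((isBigO_ascPochhammer_div a c).mul (isBigO_ascPochhammer_div b 1)).congr' ?_ ?_
  · refine .of_forall fun n => ?_
    simp only [ascPochhammer_eval_one]
    ring
  · filter_upwards [eventually_gt_atTop 0] with n hn
    rw [← Real.rpow_add (by positivity)]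
    congr 1
    simp only [add_re, sub_re, one_re]
    ring

theorem summable_ordinaryHypergeometricCoefficient (h : (a + b).re < c.re) :
    Summable (ordinaryHypergeometricCoefficient a b c) := by
  refine summable_of_isBigO_nat (Real.summable_nat_rpow.2 ?_)
    (isBigO_ordinaryHypergeometricCoefficient a b c)
  rw [sub_re]
  linarith

theorem tendsto_natCast_mul_ordinaryHypergeometricCoefficient (h : (a + b).re < c.re) :
    Tendsto (fun n : ℕ => (n : ℂ) * ordinaryHypergeometricCoefficient a b c n) atTop (𝓝 0) := by
  have hcast : (fun n : ℕ => (n : ℂ)) =O[atTop] fun n : ℕ => (n : ℝ) :=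
    isBigO_of_le _ fun n => by simp
  have hexp : 1 + ((a + b - c).re - 1) = -(c.re - (a + b).re) := by rw [sub_re]; ring
  have hO : (fun n : ℕ => (n : ℂ) * ordinaryHypergeometricCoefficient a b c n) =O[atTop]
      fun n : ℕ => (n : ℝ) ^ (-(c.re - (a + b).re)) := by
    refine (hcast.mul (isBigO_ordinaryHypergeometricCoefficient a b c)).congr_right fun n => ?_
    rw [← hexp, Real.rpow_one_add' n.cast_nonneg (by rw [hexp]; linarith)]
  exact hO.trans_tendsto
    ((tendsto_rpow_neg_atTop (sub_pos.2 h)).comp tendsto_natCast_atTop_atTop)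

theorem re_add_lt_re_add_natCast (h : (a + b).re < c.re) (m : ℕ) : (a + b).re < (c + m).re := by
  rw [add_re c, natCast_re]
  exact h.trans_le (le_add_of_nonneg_right m.cast_nonneg)

theorem norm_ordinaryHypergeometricCoefficient_le (a b : ℂ) {σ : ℝ} (hσ : 0 < σ) {w : ℂ}
    (hw : σ ≤ w.re) (n : ℕ) :
    ‖ordinaryHypergeometricCoefficient a b w n‖ ≤ ‖ordinaryHypergeometricCoefficient a b σ n‖ := by
  have hpos : 0 < ‖(ascPochhammer ℂ n).eval (σ : ℂ)‖ := by
    refine norm_pos_iff.2 (ascPochhammer_eval_ne_zero (fun m h => ?_) n)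
    have hre : σ = -m := by simpa using congrArg re h
    linarith [m.cast_nonneg (α := ℝ)]
  simp only [norm_mul, norm_inv]
  gcongr
  exact norm_ascPochhammer_eval_ofReal_le hσ.le hw n

/-- For `m ≥ M` with `σ = Re c + M > 0` the coefficients of `₂F₁(a, b; σ; ·)` dominate. -/
theorem exists_summable_norm_ordinaryHypergeometricCoefficient_le (h : (a + b).re < c.re) :
    ∃ g : ℕ → ℝ, Summable g ∧
      ∀ m n : ℕ, ‖ordinaryHypergeometricCoefficient a b (c + m) n‖ ≤ g n := by
  obtain ⟨M, hM⟩ := exists_nat_gt (-c.re)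
  have hσ : (a + b).re < ((c.re + M : ℝ) : ℂ).re := by
    rw [ofReal_re]
    exact h.trans_le (le_add_of_nonneg_right M.cast_nonneg)
  refine ⟨fun n => ∑ m ∈ Finset.range M, ‖ordinaryHypergeometricCoefficient a b (c + m) n‖ +
    ‖ordinaryHypergeometricCoefficient a b (c.re + M : ℝ) n‖, ?_, fun m n => ?_⟩
  · exact (summable_sum fun m _ => (summable_ordinaryHypergeometricCoefficient
      (re_add_lt_re_add_natCast h m)).norm).add (summable_ordinaryHypergeometricCoefficient hσ).norm
  · rcases lt_or_ge m M with hm | hm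
    · exact le_add_of_le_of_nonneg (Finset.single_le_sum
        (f := fun m : ℕ => ‖ordinaryHypergeometricCoefficient a b (c + m) n‖)
        (fun _ _ => norm_nonneg _) (Finset.mem_range.2 hm)) (norm_nonneg _)
    · refine le_add_of_nonneg_of_le (Finset.sum_nonneg fun _ _ => norm_nonneg _)
        (norm_ordinaryHypergeometricCoefficient_le a b (by linarith) ?_ n)
      simpa using hm

theorem ordinaryHypergeometric_eq_tsum_coefficient (a b c z : ℂ) :
    ordinaryHypergeometric a b c z = ∑' n, ordinaryHypergeometricCoefficient a b c n * z ^ n := by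
  simp only [ordinaryHypergeometric_eq_tsum, smul_eq_mul]

theorem ordinaryHypergeometric_one_eq_tsum (a b c : ℂ) :
    ordinaryHypergeometric a b c (1 : ℂ) = ∑' n, ordinaryHypergeometricCoefficient a b c n := by
  simp only [ordinaryHypergeometric_eq_tsum_coefficient, one_pow, mul_one]

theorem norm_mul_pow_le_of_norm_le_one (w : ℂ) {z : ℂ} (hz : ‖z‖ ≤ 1) (n : ℕ) :
    ‖w * z ^ n‖ ≤ ‖w‖ := by
  rw [norm_mul, norm_pow]
  exact mul_le_of_le_one_right (norm_nonneg _) (pow_le_one₀ (norm_nonneg _) hz)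

theorem summable_ordinaryHypergeometricCoefficient_mul_pow (h : (a + b).re < c.re) {z : ℂ}
    (hz : ‖z‖ ≤ 1) : Summable fun n => ordinaryHypergeometricCoefficient a b c n * z ^ n :=
  (summable_ordinaryHypergeometricCoefficient h).norm.of_norm_bounded
    fun n => norm_mul_pow_le_of_norm_le_one _ hz n

theorem continuousOn_ordinaryHypergeometric (h : (a + b).re < c.re) :
    ContinuousOn (ordinaryHypergeometric a b c) (closedBall (0 : ℂ) 1) := by
  rw [funext (ordinaryHypergeometric_eq_tsum_coefficient a b c)]
  exact continuousOn_tsum (fun n => by fun_prop) (summable_ordinaryHypergeometricCoefficient h).norm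
    fun n z hz => norm_mul_pow_le_of_norm_le_one _ (mem_closedBall_zero_iff.1 hz) n

theorem exists_norm_ordinaryHypergeometric_add_natCast_le (h : (a + b).re < c.re) :
    ∃ C : ℝ, ∀ (m : ℕ) (z : ℂ), ‖z‖ ≤ 1 → ‖ordinaryHypergeometric a b (c + m) z‖ ≤ C := by
  obtain ⟨g, hg, hle⟩ := exists_summable_norm_ordinaryHypergeometricCoefficient_le h
  refine ⟨∑' n, g n, fun m z hz => ?_⟩
  rw [ordinaryHypergeometric_eq_tsum_coefficient]
  exact tsum_of_norm_bounded hg.hasSum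
    fun n => (norm_mul_pow_le_of_norm_le_one _ hz n).trans (hle m n)

theorem tendsto_ordinaryHypergeometricCoefficient_add_natCast (a b c : ℂ) {n : ℕ} (hn : n ≠ 0) :
    Tendsto (fun m : ℕ => ordinaryHypergeometricCoefficient a b (c + m) n) atTop (𝓝 0) := by
  have hdeg : 0 < (ascPochhammer ℂ n).degree := by
    rwa [← Polynomial.natDegree_pos_iff_degree_pos, ascPochhammer_natDegree, Nat.pos_iff_ne_zero]
  have hnorm : Tendsto (fun m : ℕ => ‖c + m‖) atTop atTop :=
    tendsto_atTop_mono (fun m => by simpa using re_le_norm (c + m))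
      (tendsto_atTop_add_const_left atTop c.re tendsto_natCast_atTop_atTop)
  have hinv : Tendsto (fun m : ℕ => ((ascPochhammer ℂ n).eval (c + m))⁻¹) atTop (𝓝 0) :=
    tendsto_inv₀_cobounded.comp
      (tendsto_norm_atTop_iff_cobounded.1 (Polynomial.tendsto_norm_atTop _ hdeg hnorm))
  simpa using hinv.const_mul
    ((n ! : ℂ)⁻¹ * (ascPochhammer ℂ n).eval a * (ascPochhammer ℂ n).eval b)

theorem tendsto_ordinaryHypergeometric_one_add_natCast (h : (a + b).re < c.re) :
    Tendsto (fun m : ℕ => ordinaryHypergeometric a b (c + m) (1 : ℂ)) atTop (𝓝 1) := by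
  obtain ⟨g, hg, hle⟩ := exists_summable_norm_ordinaryHypergeometricCoefficient_le h
  have hlim : Tendsto (fun m : ℕ => ∑' n, ordinaryHypergeometricCoefficient a b (c + m) n) atTop
      (𝓝 (∑' n : ℕ, if n = 0 then (1 : ℂ) else 0)) := by
    refine tendsto_tsum_of_dominated_convergence hg (fun n => ?_) (.of_forall hle)
    rcases eq_or_ne n 0 with rfl | hn
    · simp [ordinaryHypergeometricCoefficient]
    · simpa only [hn, if_false] using tendsto_ordinaryHypergeometricCoefficient_add_natCast a b c hn
  simpa only [ordinaryHypergeometric_one_eq_tsum, tsum_ite_eq] using hlim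

theorem ordinaryHypergeometric_one_contiguous (h : (a + b).re < c.re) (hc : ∀ m : ℕ, c ≠ -m) :
    c * (c - a - b) * ordinaryHypergeometric a b c (1 : ℂ) =
      (c - a) * (c - b) * ordinaryHypergeometric a b (c + 1) (1 : ℂ) := by
  have hsum := ((summable_ordinaryHypergeometricCoefficient (a := a) (b := b) (c := c + 1)
    (by simpa using re_add_lt_re_add_natCast h 1)).mul_left ((c - a) * (c - b))).hasSum.sub
    ((summable_ordinaryHypergeometricCoefficient h).mul_left (c * (c - a - b))).hasSum
  have hpartial := hsum.tendsto_sum_nat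
  simp only [ordinaryHypergeometricCoefficient_contiguous a b hc,
    Finset.sum_range_sub fun n : ℕ => c * (n * ordinaryHypergeometricCoefficient a b c n),
    Nat.cast_zero, zero_mul, mul_zero, sub_zero, tsum_mul_left,
    ← ordinaryHypergeometric_one_eq_tsum] at hpartial
  have hzero := tendsto_nhds_unique hpartial
    ((tendsto_natCast_mul_ordinaryHypergeometricCoefficient h).const_mul c)
  rw [mul_zero, sub_eq_zero] at hzero
  exact hzero.symm

theorem ordinaryHypergeometric_one_add_natCast (h : (a + b).re < c.re) (hc : ∀ m : ℕ, c ≠ -m)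
    (n : ℕ) :
    (ascPochhammer ℂ n).eval c * (ascPochhammer ℂ n).eval (c - a - b) *
        ordinaryHypergeometric a b c (1 : ℂ) =
      (ascPochhammer ℂ n).eval (c - a) * (ascPochhammer ℂ n).eval (c - b) *
        ordinaryHypergeometric a b (c + n) (1 : ℂ) := by
  induction n with
  | zero => simp
  | succ n ih =>
    have hstep := ordinaryHypergeometric_one_contiguous (re_add_lt_re_add_natCast h n)
      fun m hm => hc (m + n) (by push_cast; linear_combination hm)
    simp only [ascPochhammer_succ_eval]
    push_cast
    rw [← add_assoc]
    linear_combination (c + n) * (c + n - a - b) * ih +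
      (ascPochhammer ℂ n).eval (c - a) * (ascPochhammer ℂ n).eval (c - b) * hstep

theorem ordinaryHypergeometric_one (h : (a + b).re < c.re) (hc : ∀ m : ℕ, c ≠ -m) :
    ordinaryHypergeometric a b c (1 : ℂ) =
      Gamma c * Gamma (c - a - b) / (Gamma (c - a) * Gamma (c - b)) := by
  have hcab : ∀ m : ℕ, c - a - b ≠ -m := fun m hm => by
    have hre : c.re - a.re - b.re = -m := by simpa using congrArg re hm
    rw [add_re] at h
    linarith [m.cast_nonneg (α := ℝ)]
  have hlim := ((tendsto_ascPochhammer_div_mul_cpow (c - a) c).mul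
    (tendsto_ascPochhammer_div_mul_cpow (c - b) (c - a - b))).mul
    (tendsto_ordinaryHypergeometric_one_add_natCast h)
  rw [mul_one, div_mul_div_comm] at hlim
  refine tendsto_nhds_unique (tendsto_const_nhds.congr' ?_) hlim
  filter_upwards [eventually_ne_atTop 0] with n hn
  have hpow : (n : ℂ) ^ (c - (c - a)) * (n : ℂ) ^ (c - a - b - (c - b)) = 1 := by
    rw [← cpow_add _ _ (Nat.cast_ne_zero.2 hn), sub_add_sub_comm]
    ring_nf
    exact cpow_zero _
  have hne := ascPochhammer_eval_ne_zero hc n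
  have hne' := ascPochhammer_eval_ne_zero hcab n
  rw [mul_mul_mul_comm, hpow, mul_one, div_mul_div_comm, div_mul_eq_mul_div,
    eq_div_iff (mul_ne_zero hne hne'), mul_comm]
  exact ordinaryHypergeometric_one_add_natCast h hc n

end Hypergeometric

section Heun

open Metric

variable {a q α β γ δ ε : ℂ}

theorem summable_heunTerm (hcoeff : Summable (heunCoeff a q α β γ δ ε))
    (h : (α + β).re < (γ + ε).re) {z : ℂ} (hz : ‖z‖ ≤ 1) :
    Summable (heunTerm a q α β γ δ ε z) := by
  obtain ⟨C, hC⟩ := exists_norm_ordinaryHypergeometric_add_natCast_le h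
  refine (hcoeff.norm.mul_right C).of_norm_bounded fun n => ?_
  exact (norm_mul _ _).trans_le (mul_le_mul_of_nonneg_left (hC n z hz) (norm_nonneg _))

theorem continuousOn_heunExpansion (hcoeff : Summable (heunCoeff a q α β γ δ ε))
    (h : (α + β).re < (γ + ε).re) :
    ContinuousOn (heunExpansion a q α β γ δ ε) (closedBall 0 1) := by
  obtain ⟨C, hC⟩ := exists_norm_ordinaryHypergeometric_add_natCast_le h
  refine continuousOn_tsum (fun n => ?_) (hcoeff.norm.mul_right C) fun n z hz => ?_
  · exact (continuousOn_ordinaryHypergeometric (re_add_lt_re_add_natCast h n)).const_mul _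
  · exact (norm_mul _ _).trans_le
      (mul_le_mul_of_nonneg_left (hC n z (mem_closedBall_zero_iff.1 hz)) (norm_nonneg _))

theorem heunQ_eq_zero (ha : a = 1 / 2) (hγδ : γ + δ = 2)
    (hq : q = a * α * β + a * (1 - δ) * ε) (n : ℕ) : heunQ a q α β γ δ ε n = 0 := by
  obtain rfl : δ = 2 - γ := eq_sub_of_add_eq' hγδ
  subst ha hq
  simp only [heunQ, heunR]
  ring

theorem heunCoeff_add_two_of_heunQ_eq_zero (hQ : ∀ n, heunQ a q α β γ δ ε n = 0) (n : ℕ) :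
    heunCoeff a q α β γ δ ε (n + 2) =
      -heunP a α β γ ε n / heunR a γ ε (n + 2) * heunCoeff a q α β γ δ ε n := by
  rw [heunCoeff, hQ]
  ring

theorem heunCoeff_eq_zero_of_notMem_range_two_mul (hQ : ∀ n, heunQ a q α β γ δ ε n = 0) {n : ℕ}
    (hn : n ∉ Set.range fun k : ℕ => 2 * k) : heunCoeff a q α β γ δ ε n = 0 := by
  obtain ⟨k, rfl | rfl⟩ := n.even_or_odd'
  · exact absurd ⟨k, rfl⟩ hn
  clear hn
  induction k with
  | zero => rw [mul_zero, zero_add, heunCoeff, hQ, neg_zero, zero_div]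
  | succ k ih =>
    rw [mul_add_one, add_right_comm, heunCoeff_add_two_of_heunQ_eq_zero hQ, ih, mul_zero]

theorem heunCoeff_two_mul (hQ : ∀ n, heunQ (1 / 2) q α β γ δ ε n = 0) (k : ℕ) :
    heunCoeff (1 / 2) q α β γ δ ε (2 * k) =
      clausenTerm (ε / 2) ((γ + ε - α) / 2) ((γ + ε - β) / 2) ((γ + ε) / 2) ((γ + ε + 1) / 2) 1
        k := by
  induction k with
  | zero => simp [heunCoeff, clausenTerm]
  | succ k ih =>
    have h₀ : (γ + ε) / 2 + k = (2 * k + ε + γ) / 2 := by ring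
    have h₁ : (γ + ε + 1) / 2 + k = (ε + γ + (2 * k + 2) - 1) / 2 := by ring
    have h₂ : (1 - 1 / 2) * (2 * (k : ℂ) + 2) = k + 1 := by ring
    rw [mul_add_one, heunCoeff_add_two_of_heunQ_eq_zero hQ, ih, clausenTerm_succ, h₀, h₁]
    simp only [heunP, heunR]
    push_cast
    rw [h₂]
    simp only [div_eq_mul_inv, mul_inv, inv_inv]
    ring

theorem summable_heunCoeff (hQ : ∀ n, heunQ (1 / 2) q α β γ δ ε n = 0)
    (h : ε.re < (α + β).re + 1) : Summable (heunCoeff (1 / 2) q α β γ δ ε) := by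
  refine ((mul_right_injective₀ two_ne_zero).summable_iff
    fun n hn => heunCoeff_eq_zero_of_notMem_range_two_mul hQ hn).1 ?_
  refine (summable_clausenTerm_one ?_).congr fun k => (heunCoeff_two_mul hQ k).symm
  simp only [Complex.add_re, Complex.sub_re, Complex.one_re, Complex.div_ofNat_re] at h ⊢
  linarith

theorem heunTerm_one_two_mul (hQ : ∀ n, heunQ (1 / 2) q α β γ δ ε n = 0)
    (h : (α + β).re < (γ + ε).re) (hγε : ∀ m : ℕ, γ + ε ≠ -(m : ℂ))
    (hα : ∀ m : ℕ, (γ + ε - α + 1) / 2 ≠ -(m : ℂ))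
    (hβ : ∀ m : ℕ, (γ + ε - β + 1) / 2 ≠ -(m : ℂ)) (k : ℕ) :
    heunTerm (1 / 2) q α β γ δ ε 1 (2 * k) =
      ordinaryHypergeometric α β (γ + ε) (1 : ℂ) *
        clausenTerm ((γ + ε - α - β) / 2) ((γ + ε - α - β + 1) / 2) (ε / 2)
          ((γ + ε - β + 1) / 2) ((γ + ε - α + 1) / 2) 1 k := by
  have hshift := ordinaryHypergeometric_one_add_natCast h hγε (2 * k)
  rw [heunTerm, heunCoeff_two_mul hQ]
  generalize ordinaryHypergeometric α β (γ + ε) (1 : ℂ) = F at *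
  generalize ordinaryHypergeometric α β (γ + ε + (2 * k : ℕ)) (1 : ℂ) = G at *
  generalize γ + ε = s at *
  have hs₀ := ascPochhammer_eval_ne_zero (x := s / 2)
    (fun m hm => hγε (2 * m) (by push_cast; linear_combination 2 * hm)) k
  have hs₁ := ascPochhammer_eval_ne_zero (x := (s + 1) / 2)
    (fun m hm => hγε (2 * m + 1) (by push_cast; linear_combination 2 * hm)) k
  have hsα := ascPochhammer_eval_ne_zero hα k
  have hsβ := ascPochhammer_eval_ne_zero hβ k
  simp only [ascPochhammer_two_mul_eval] at hshift
  have hfac : (k.factorial : ℂ) ≠ 0 := Nat.cast_ne_zero.2 k.factorial_ne_zero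
  have hpow : (4 : ℂ) ^ k * 4 ^ k ≠ 0 := by simp
  simp only [clausenTerm, one_pow, mul_one]
  rw [div_mul_eq_mul_div, ← mul_div_assoc, div_eq_div_iff
    (mul_ne_zero (mul_ne_zero hs₀ hs₁) hfac) (mul_ne_zero (mul_ne_zero hsβ hsα) hfac)]
  refine mul_left_cancel₀ hpow ?_
  linear_combination -((ascPochhammer ℂ k).eval (ε / 2) * (k.factorial : ℂ)) * hshift

theorem heunExpansion_one (hQ : ∀ n, heunQ (1 / 2) q α β γ δ ε n = 0)
    (h : (α + β).re < (γ + ε).re) (hγε : ∀ m : ℕ, γ + ε ≠ -(m : ℂ))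
    (hα : ∀ m : ℕ, (γ + ε - α + 1) / 2 ≠ -(m : ℂ))
    (hβ : ∀ m : ℕ, (γ + ε - β + 1) / 2 ≠ -(m : ℂ)) :
    heunExpansion (1 / 2) q α β γ δ ε 1 =
      ordinaryHypergeometric α β (γ + ε) (1 : ℂ) *
        clausen ((γ + ε - α - β) / 2) ((γ + ε - α - β + 1) / 2) (ε / 2)
          ((γ + ε - β + 1) / 2) ((γ + ε - α + 1) / 2) 1 := by
  have hsupp : Function.support (heunTerm (1 / 2) q α β γ δ ε 1) ⊆ Set.range fun k : ℕ => 2 * k :=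
    Function.support_subset_iff'.2 fun n hn => by
      rw [heunTerm, heunCoeff_eq_zero_of_notMem_range_two_mul hQ hn, zero_mul]
  rw [heunExpansion, clausen, ← tsum_mul_left,
    ← (mul_right_injective₀ two_ne_zero).tsum_eq hsupp]
  exact tsum_congr (heunTerm_one_two_mul hQ h hγε hα hβ)

theorem mainTheorem7_general (ha : a = 1 / 2) (hγδ : γ + δ = 2)
    (hq : q = a * α * β + a * (1 - δ) * ε)
    (h : (α + β).re < (γ + ε).re) (hε : ε.re < (α + β).re + 1)
    (hγε : ∀ m : ℕ, γ + ε ≠ -(m : ℂ))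
    (hα : ∀ m : ℕ, (γ + ε - α + 1) / 2 ≠ -(m : ℂ))
    (hβ : ∀ m : ℕ, (γ + ε - β + 1) / 2 ≠ -(m : ℂ)) :
    (∀ z : ℂ, ‖z‖ ≤ 1 →
      (∀ n : ℕ, Summable fun j : ℕ =>
        ordinaryHypergeometricCoefficient α β (γ + ε + n) j * z ^ j) ∧
      Summable (heunTerm a q α β γ δ ε z)) ∧
    ContinuousOn (heunExpansion a q α β γ δ ε) (closedBall 0 1) ∧
    Summable (clausenTerm ((γ + ε - α - β) / 2) ((γ + ε - α - β + 1) / 2) (ε / 2)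
      ((γ + ε - β + 1) / 2) ((γ + ε - α + 1) / 2) 1) ∧
    heunExpansion a q α β γ δ ε 1 =
      Complex.Gamma (γ + ε) * Complex.Gamma (γ + ε - α - β) /
          (Complex.Gamma (γ + ε - α) * Complex.Gamma (γ + ε - β)) *
        clausen ((γ + ε - α - β) / 2) ((γ + ε - α - β + 1) / 2) (ε / 2)
          ((γ + ε - β + 1) / 2) ((γ + ε - α + 1) / 2) 1 := by
  have hQ := heunQ_eq_zero ha hγδ hq
  rw [ha] at hQ ⊢
  have hcoeff := summable_heunCoeff hQ hε
  refine ⟨fun z hz => ⟨fun n => ?_, summable_heunTerm hcoeff h hz⟩,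
    continuousOn_heunExpansion hcoeff h, summable_clausenTerm_one ?_, ?_⟩
  · exact summable_ordinaryHypergeometricCoefficient_mul_pow (re_add_lt_re_add_natCast h n) hz
  · simp only [Complex.add_re, Complex.sub_re, Complex.one_re, Complex.div_ofNat_re] at hε ⊢
    linarith
  · rw [heunExpansion_one hQ h hγε hα hβ, ordinaryHypergeometric_one h hγε]

end Heun

theorem mainTheorem7 (a q α β γ δ ε : ℂ)
    (hFuchs : 1 + α + β = γ + δ + ε)
    (ha : a = 1 / 2) (hγδ : γ + δ = 2) (hq : q = a * α * β + a * (1 - δ) * ε)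
    (hγ : 1 < γ.re)
    (hγε : ∀ m : ℕ, γ + ε ≠ -(m : ℂ))
    (hγα : ∀ m : ℕ, (γ + α) / 2 ≠ -(m : ℂ))
    (hγβ : ∀ m : ℕ, (γ + β) / 2 ≠ -(m : ℂ)) :
    (∀ z : ℂ, ‖z‖ ≤ 1 →
      (∀ n : ℕ, Summable fun j : ℕ =>
        ordinaryHypergeometricCoefficient α β (γ + ε + n) j * z ^ j) ∧
      Summable (heunTerm a q α β γ δ ε z)) ∧
    ContinuousWithinAt (heunExpansion a q α β γ δ ε) (Metric.closedBall 0 1) 1 ∧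
    Summable (clausenTerm ((γ - 1) / 2) (γ / 2) (ε / 2) ((γ + α) / 2) ((γ + β) / 2) 1) ∧
    heunExpansion a q α β γ δ ε 1 =
      Complex.Gamma (γ + ε) * Complex.Gamma (γ - 1) /
          (Complex.Gamma (γ + ε - α) * Complex.Gamma (γ - 1 + α)) *
        clausen ((γ - 1) / 2) (γ / 2) (ε / 2) ((γ + α) / 2) ((γ + β) / 2) 1 := by
  have hs : γ + ε - α - β = γ - 1 := by linear_combination -hFuchs - hγδ
  have hsβ : γ + ε - β = γ - 1 + α := by linear_combination hs
  have hα : γ + ε - α + 1 = γ + β := by linear_combination hs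
  have hβ : γ + ε - β + 1 = γ + α := by linear_combination hs
  have hre : (α + β).re < (γ + ε).re := by
    rw [← sub_pos, ← Complex.sub_re, ← sub_sub, hs]
    simpa using hγ
  have hε : ε.re < (α + β).re + 1 := by
    rw [show α + β = ε + 1 by linear_combination -hs, Complex.add_re, Complex.one_re]
    linarith
  obtain ⟨hsum, hcont, hclausen, hval⟩ := mainTheorem7_general ha hγδ hq hre hε hγε
    (by simpa only [hα] using hγβ) (by simpa only [hβ] using hγα)
  rw [hs, hα, hβ, sub_add_cancel] at hclausen hval
  rw [hsβ] at hval
  exact ⟨hsum, hcont 1 (by simp), hclausen, hval⟩
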